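/- Let $M$ and $N$ be compact connected $3$-manifolds with (possibly empty) incompressible toral boundary, i.e. every boundary component is a torus whose inclusion is injective on $\pi_1$; orientability is not required. For each boundary component $\partial_iM$ of $M$ choose a conjugacy representative $\pi_1\partial_iM\le\pi_1M$ of its peripheral subgroup, that is, the image of $\pi_1(\partial_iM)$ in $\pi_1M$ with respect to some base point of $\partial_iM$ and some path joining it to the base point of $M$; choose $\pi_1\partial_jN\le\pi_1N$ in the same way. For a group $G$ let $\widehat G$ be its profinite completion, and for a subgroup $P\le G$ let $\overline P$ be the closure of the image of $P$ in $\widehat G$. Let $f:\widehat{\pi_1M}\to\widehat{\pi_1N}$ be a peripheral regular isomorphism of profinite groups. Precisely, suppose that we are given a one-to-one correspondence $\partial_iM\leftrightarrow\partial_iN$ between the boundary components, elements $g_i\in\widehat{\pi_1N}$ with $f(\overline{\pi_1\partial_iM})=g_i^{-1}\,\overline{\pi_1\partial_iN}\,g_i$, and group isomorphisms $\psi_i:\pi_1\partial_iM\to\pi_1\partial_iN$ such that the map $x\mapsto g_if(x)g_i^{-1}$ from $\overline{\pi_1\partial_iM}$ to $\overline{\pi_1\partial_iN}$ is the profinite completion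 of $\psi_i$; that is, $g_i\,f(a_i(x))\,g_i^{-1}=b_i(\widehat{\psi_i}(x))$ for all $x\in\widehat{\pi_1\partial_iM}$, where $a_i:\widehat{\pi_1\partial_iM}\to\widehat{\pi_1M}$ and $b_i:\widehat{\pi_1\partial_iN}\to\widehat{\pi_1N}$ are induced by the inclusions. Let $n\in\mathbb N$. Then for every representation $\theta:\pi_1N\to\mathrm{SL}(n,\mathbb C)$ there is a representation $\phi:\pi_1M\to\mathrm{SL}(n,\mathbb C)$ such that for every $i$ the representations $\phi|_{\pi_1\partial_iM}$ and $\theta|_{\pi_1\partial_iN}\circ\psi_i$ of $\pi_1\partial_iM$ are conjugate in $\mathrm{SL}(n,\mathbb C)$, i.e. there is $A_i\in\mathrm{SL}(n,\mathbb C)$ with $\phi(\alpha)=A_i\,\theta(\psi_i(\alpha))\,A_i^{-1}$ for all $\alpha\in\pi_1\partial_iM$. Moreover, $\phi$ can be chosen so that, in addition, it is non-abelian (i.e. has non-commutative image) if $\theta$ is non-abelian, and it is irreducible if $\theta$ is irreducible. -/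

import Mathlib

open scoped Manifold MatrixGroups

universe u

noncomputable section

/-! ### Profinite completions of discrete groups -/

/-- The profinite completion `Ĝ = lim G / K`, over the normal subgroups `K` of finite index. -/
abbrev ProfiniteHat (G : Type u) [Group G] : ProfiniteGrp.{u} :=
  ProfiniteGrp.ProfiniteCompletion.completion (GrpCat.of G)

/-- The canonical homomorphism `G → Ĝ`, `g ↦ (g K)_K`. -/
def toHat (G : Type u) [Group G] : G →* ProfiniteHat G :=
  (ProfiniteGrp.ProfiniteCompletion.eta (GrpCat.of G)).hom

/-- The profinite completion `Ĝ → Ĥ` of a homomorphism `G → H`. -/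
def hatMap {G H : Type u} [Group G] [Group H] (φ : G →* H) :
    ProfiniteHat G →ₜ* ProfiniteHat H :=
  (ProfiniteGrp.profiniteCompletion.map (GrpCat.ofHom φ)).hom

/-- The closure in `Ĝ` of (the image of) a subgroup of `G`. -/
def hatClosure {G : Type u} [Group G] (P : Subgroup G) : Set (ProfiniteHat G) :=
  closure (toHat G '' (P : Set G))

/-! ### 3-manifolds with boundary and their peripheral subgroups

A 3-manifold with boundary is a Hausdorff space with an atlas modelled on the closed half-space
of dimension 3 (for the compact ones considered here second countability is automatic). -/

section Manifold

variable (M : Type u) [TopologicalSpace M] [ChartedSpace (EuclideanHalfSpace 3) M]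

/-- The set of connected components of the boundary of `M`. -/
abbrev BoundaryComponent : Type u := ConnectedComponents ((𝓡∂ 3).boundary M)

variable {M}

/-- The subset of `M` underlying a boundary component. -/
def BoundaryComponent.carrier (C : BoundaryComponent M) : Set M :=
  {x | ∃ hx : x ∈ (𝓡∂ 3).boundary M,
    ConnectedComponents.mk (⟨x, hx⟩ : (𝓡∂ 3).boundary M) = C}

/-- The inclusion of a boundary component into `M`. -/
def BoundaryComponent.incl (C : BoundaryComponent M) : C(BoundaryComponent.carrier C, M) :=
  ⟨Subtype.val, continuous_subtype_val⟩

variable (M) in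
/-- Every boundary component is a torus, and its inclusion into `M` is injective on `π₁`. -/
def HasIncompressibleToralBoundary : Prop :=
  ∀ C : BoundaryComponent M,
    Nonempty (BoundaryComponent.carrier C ≃ₜ Circle × Circle) ∧
    ∀ y : BoundaryComponent.carrier C,
      Function.Injective (FundamentalGroup.map (BoundaryComponent.incl C) y)

/-- `P ≤ π₁(M, x₀)` is a conjugacy representative of the peripheral subgroup of the boundary
component `C`: the image of `π₁(C, y) → π₁(M, y) ≅ π₁(M, x₀)` for some base point `y` of `C` and
some path `γ` in `M` from `y` to `x₀`. -/
def IsPeripheralSubgroup (x₀ : M) (C : BoundaryComponent M)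
    (P : Subgroup (FundamentalGroup M x₀)) : Prop :=
  ∃ (y : BoundaryComponent.carrier C) (γ : Path (BoundaryComponent.incl C y) x₀),
    P = (FundamentalGroup.map (BoundaryComponent.incl C) y).range.map
      (FundamentalGroup.fundamentalGroupMulEquivOfPath γ).toMonoidHom

end Manifold

/-! ### Peripheral regularity -/

/-- The data showing that an isomorphism of profinite groups `f : π₁(M)^ ≃ π₁(N)^` is peripheral
regular, relative to conjugacy representatives `P i`, `Q j` of the peripheral subgroups:
a bijection between the boundary components and elements `g i` of `π₁(N)^` with
`f (closure (P i)) = (g i)⁻¹ * closure (Q (σ i)) * g i`, and isomorphisms `ψ i : P i ≃ Q (σ i)`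
whose profinite completion is the restriction of `x ↦ g i * f x * (g i)⁻¹` to `closure (P i)`.
The last condition is read through the canonical maps from the completions of `P i` and `Q (σ i)`
onto their closures in `π₁(M)^` and `π₁(N)^`. -/
structure PeripheralRegularData
    {M : Type u} [TopologicalSpace M] [ChartedSpace (EuclideanHalfSpace 3) M]
    {N : Type u} [TopologicalSpace N] [ChartedSpace (EuclideanHalfSpace 3) N]
    {x₀ : M} {y₀ : N}
    (P : BoundaryComponent M → Subgroup (FundamentalGroup M x₀))
    (Q : BoundaryComponent N → Subgroup (FundamentalGroup N y₀))
    (f : ProfiniteHat (FundamentalGroup M x₀) ≃ₜ* ProfiniteHat (FundamentalGroup N y₀)) where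
  σ : BoundaryComponent M ≃ BoundaryComponent N
  g : BoundaryComponent M → ProfiniteHat (FundamentalGroup N y₀)
  image_closure : ∀ i, f '' hatClosure (P i) =
    (fun x => (g i)⁻¹ * x * g i) '' hatClosure (Q (σ i))
  ψ : ∀ i, P i ≃* Q (σ i)
  completion_eq : ∀ (i) (x : ProfiniteHat (P i)),
    g i * f (hatMap (P i).subtype x) * (g i)⁻¹ =
      hatMap (Q (σ i)).subtype (hatMap (ψ i).toMonoidHom x)

/-! ### Representations into `SL(n, ℂ)` -/

/-- The linear representation on `ℂⁿ` given by a homomorphism to `SL(n, ℂ)`. -/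
def slRepresentation {G : Type u} [Group G] {n : ℕ} (ρ : G →* SL(n, ℂ)) :
    Representation ℂ G (Fin n → ℂ) where
  toFun a := Matrix.toLin' (ρ a : Matrix (Fin n) (Fin n) ℂ)
  map_one' := by simp [Module.End.one_eq_id]
  map_mul' a b := by simp [Module.End.mul_eq_comp, Matrix.toLin'_mul]

/-- A homomorphism to `SL(n, ℂ)` is non-abelian if its image is not commutative. -/
def IsNonabelianRep {G : Type u} [Group G] {n : ℕ} (ρ : G →* SL(n, ℂ)) : Prop :=
  ∃ a b : G, ρ a * ρ b ≠ ρ b * ρ a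

end

/-! Since `N` is compact, its group is finitely generated, so the entries of `θ` on generators are
finitely many complex numbers. For a suitable prime `p`, a field isomorphism of `ℂ` with an
algebraic closure of `ℚ_[p]` makes all of them integral over `ℤ_[p]`
(`exists_ringEquiv_padicAlgCl_isIntegral`). Hence `θ` comes from a homomorphism to `SL(n, R)`, with
`R` a finite `ℤ_[p]`-algebra (`exists_compact_model`). This group is profinite, so the homomorphism
extends continuously to the completion; composing with `f` and restricting to the group of `M` gives
`φ`.

On a peripheral subgroup, `f` agrees with `ψ i` up to conjugation by `g i`, so `φ` agrees with `θ ∘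
ψ i` up to conjugation by the image of `(g i)⁻¹`. Both groups are dense in the same completion and
submodules of matrices over `R` are closed, so `φ` and `θ` have the same linear span. The span
determines the invariant subspaces and whether the image commutes. -/

/-! ### Making finitely many complex numbers p-adically integral -/

/-- With `a = p` this moves a transcendence basis of `ℤ_[p]` into prescribed residue classes mod
`p`. Each `y i` remains algebraic over the new family, as a root of a linear polynomial with leading
coefficient `a ≠ 0`. -/
theorem isTranscendenceBasis_affine {ι R A : Type*} [CommRing R] [IsDomain R] [CommRing A]
    [IsDomain A] [Algebra R A] {y : ι → A} (hy : IsTranscendenceBasis R y) (c : ι → R) {a : R}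
    (ha : a ≠ 0) :
    IsTranscendenceBasis R fun i => algebraMap R A (c i) + algebraMap R A a * y i := by
  have hinj : Function.Injective (algebraMap R A) := hy.1.algebraMap_injective
  have hind : AlgebraicIndependent R fun i => algebraMap R A (c i) + algebraMap R A a * y i := by
    have h := hy.1.polynomial_aeval_of_transcendental
      (f := fun i => Polynomial.C (c i) + Polynomial.C a * Polynomial.X) fun i => by
        apply Polynomial.transcendental
        · rw [add_comm, Polynomial.natDegree_linear ha]
          exact one_ne_zero
        · rw [add_comm, Polynomial.leadingCoeff_linear ha]
          exact mem_nonZeroDivisors_of_ne_zero ha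
    simpa using h
  rw [hind.isTranscendenceBasis_iff_isAlgebraic, hy.isAlgebraic_iff]
  intro i
  set S := Algebra.adjoin R (Set.range fun i => algebraMap R A (c i) + algebraMap R A a * y i)
  let w : S := ⟨_, Algebra.subset_adjoin (Set.mem_range_self i)⟩
  refine ⟨Polynomial.C (algebraMap R S a) * Polynomial.X +
    Polynomial.C (algebraMap R S (c i) - w), ?_, ?_⟩
  · intro h
    have h1 := congrArg (fun q => Polynomial.coeff q 1) h
    simp only [Polynomial.coeff_add, Polynomial.coeff_C_mul, Polynomial.coeff_X_one, mul_one,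
      Polynomial.coeff_C_of_ne_zero one_ne_zero, add_zero, Polynomial.coeff_zero] at h1
    have h2 := congrArg (algebraMap S A) h1
    rw [← IsScalarTower.algebraMap_apply, map_zero] at h2
    exact ha (hinj (h2.trans (map_zero _).symm))
  · have : algebraMap S A w = algebraMap R A (c i) + algebraMap R A a * y i := rfl
    simp only [map_add, map_mul, Polynomial.aeval_C, Polynomial.aeval_X, map_sub,
      ← IsScalarTower.algebraMap_apply, this]
    ring

/-- Both fields are algebraic closures of the same polynomial ring over `R`. -/
theorem exists_ringEquiv_apply_eq_of_isTranscendenceBasis {ι R K L : Type*} [CommRing R]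
    [Field K] [Field L] [Algebra R K] [Algebra R L] [IsAlgClosed K] [IsAlgClosed L]
    {v : ι → K} {w : ι → L} (hv : IsTranscendenceBasis R v) (hw : IsTranscendenceBasis R w) :
    ∃ τ : K ≃+* L, ∀ q : MvPolynomial ι R,
      τ (MvPolynomial.aeval v q) = MvPolynomial.aeval w q := by
  let := IsAlgClosed.isAlgClosure_of_transcendence_basis v hv
  let := IsAlgClosed.isAlgClosure_of_transcendence_basis w hw
  let e : Algebra.adjoin R (Set.range v) ≃+* Algebra.adjoin R (Set.range w) :=
    (hv.1.aevalEquiv.symm.trans hw.1.aevalEquiv).toRingEquiv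
  refine ⟨IsAlgClosure.equivOfEquiv K L e, fun q => ?_⟩
  have h1 : MvPolynomial.aeval v q = algebraMap (Algebra.adjoin R (Set.range v)) K
      (hv.1.aevalEquiv q) := (hv.1.algebraMap_aevalEquiv q).symm
  rw [h1, IsAlgClosure.equivOfEquiv_algebraMap]
  simp [e]

open Cardinal in
theorem mk_padicAlgCl (p : ℕ) [Fact p.Prime] : #(PadicAlgCl p) = 𝔠 := by
  have h1 : 𝔠 ≤ #ℚ_[p] := continuum_le_cardinal_of_nontriviallyNormedField ℚ_[p]
  have h2 : #ℚ_[p] ≤ 𝔠 := by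
    refine (mk_quotient_le (α := CauSeq ℚ (padicNorm p))).trans ((mk_subtype_le _).trans ?_)
    simp
  have h3 : #(PadicAlgCl p) ≤ max #ℚ_[p] ℵ₀ := Algebra.IsAlgebraic.cardinalMk_le_max _ _
  refine le_antisymm (h3.trans (max_le h2 aleph0_le_continuum)) (h1.trans ?_)
  exact mk_le_of_injective (algebraMap ℚ_[p] (PadicAlgCl p)).injective

open Cardinal in
/-- Finitely many complex numbers become integral over `ℤ_[p]` under a suitable identification of
`ℂ` with an algebraic closure of `ℚ_[p]`, for a suitable prime `p`. -/
theorem exists_ringEquiv_padicAlgCl_isIntegral (s : Finset ℂ) :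
    ∃ (p : ℕ) (_ : Fact p.Prime) (τ : ℂ ≃+* PadicAlgCl p), ∀ a ∈ s, IsIntegral ℤ_[p] (τ a) := by
  obtain ⟨ι, v, hv⟩ := exists_isTranscendenceBasis' ℤ ℂ
  have := hv.isAlgebraic
  -- A common denominator `q' = Q(v)`: the multiples `Q(v) • a`, for `a ∈ s`, are integral over
  -- `ℤ[v]`.
  obtain ⟨q', hq', hint⟩ :=
    Algebra.IsAlgebraic.exists_integral_multiples (Algebra.adjoin ℤ (Set.range v)) s
  obtain ⟨Q, rfl⟩ := hv.1.aevalEquiv.surjective q'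
  have hQ : Q ≠ 0 := by rintro rfl; simp at hq'
  obtain ⟨c, hc⟩ : ∃ c : ι → ℤ, MvPolynomial.eval c Q ≠ 0 := by
    by_contra! h
    exact hQ (MvPolynomial.funext fun c => by simpa using h c)
  -- A prime larger than `|Q(c)|` cannot divide it, so `Q` is a unit at every p-adic point congruent
  -- to `c` mod `p`.
  obtain ⟨p, hpc, hp⟩ := Nat.exists_infinite_primes ((MvPolynomial.eval c Q).natAbs + 1)
  have : Fact p.Prime := ⟨hp⟩
  have hpQ : ((MvPolynomial.eval c Q : ℤ) : ZMod p) ≠ 0 := by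
    rw [Ne, ZMod.intCast_zmod_eq_zero_iff_dvd]
    intro h
    have := Int.natAbs_le_of_dvd_ne_zero h hc
    simp at this
    omega
  have hinj : Function.Injective (algebraMap ℤ_[p] (PadicAlgCl p)) := by
    rw [IsScalarTower.algebraMap_eq ℤ_[p] ℚ_[p] (PadicAlgCl p)]
    exact (algebraMap ℚ_[p] (PadicAlgCl p)).injective.comp (IsFractionRing.injective ℤ_[p] ℚ_[p])
  have : FaithfulSMul ℤ_[p] (PadicAlgCl p) := (faithfulSMul_iff_algebraMap_injective _ _).2 hinj
  have : Algebra.IsAlgebraic ℤ_[p] (PadicAlgCl p) :=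
    have := IsLocalization.isAlgebraic ℚ_[p] (nonZeroDivisors ℤ_[p])
    Algebra.IsAlgebraic.trans ℤ_[p] ℚ_[p] _
  obtain ⟨κ, y, hy⟩ := exists_isTranscendenceBasis' ℤ ℤ_[p]
  have hcard : #ι = #κ := by
    have hyL : IsTranscendenceBasis ℤ (algebraMap ℤ_[p] (PadicAlgCl p) ∘ y) := hy.algebraMap_comp
    rw [← IsAlgClosed.cardinal_eq_cardinal_transcendence_basis_of_aleph0_lt' _ hv mk_int.le
        (by rw [mk_complex]; exact aleph0_lt_continuum),
      ← IsAlgClosed.cardinal_eq_cardinal_transcendence_basis_of_aleph0_lt' _ hyL mk_int.le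
        (by rw [mk_padicAlgCl]; exact aleph0_lt_continuum), mk_complex, mk_padicAlgCl]
  obtain ⟨e⟩ := Cardinal.eq.1 hcard
  have hye : IsTranscendenceBasis ℤ (y ∘ e) := hy.comp_equiv e
  let x : ι → ℤ_[p] := fun i => algebraMap ℤ ℤ_[p] (c i) + algebraMap ℤ ℤ_[p] p * (y ∘ e) i
  have hx : IsTranscendenceBasis ℤ x :=
    isTranscendenceBasis_affine hye c (Int.natCast_ne_zero.2 hp.ne_zero)
  have hxL : IsTranscendenceBasis ℤ (algebraMap ℤ_[p] (PadicAlgCl p) ∘ x) := hx.algebraMap_comp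
  obtain ⟨τ, hτ⟩ := exists_ringEquiv_apply_eq_of_isTranscendenceBasis hv hxL
  have hτ' (q : MvPolynomial ι ℤ) : τ (MvPolynomial.aeval v q) =
      algebraMap ℤ_[p] (PadicAlgCl p) (MvPolynomial.aeval x q) := by
    rw [hτ, MvPolynomial.aeval_algebraMap_apply]
  have hunit : IsUnit (MvPolynomial.aeval x Q) := by
    have h1 : PadicInt.toZMod (MvPolynomial.aeval x Q) = ((MvPolynomial.eval c Q : ℤ) : ZMod p) := by
      have h2 : (PadicInt.toZMod (p := p)).comp
          ((MvPolynomial.aeval x : MvPolynomial ι ℤ →ₐ[ℤ] ℤ_[p]) : MvPolynomial ι ℤ →+* ℤ_[p]) =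
          (Int.castRingHom (ZMod p)).comp (MvPolynomial.eval c) := by
        apply MvPolynomial.ringHom_ext
        · simp
        · simp [x]
      exact RingHom.congr_fun h2 Q
    by_contra h
    rw [← mem_nonunits_iff, ← IsLocalRing.mem_maximalIdeal, ← PadicInt.ker_toZMod,
      RingHom.mem_ker, h1] at h
    exact hpQ h
  refine ⟨p, inferInstance, τ, fun a ha => ?_⟩
  let φ : Algebra.adjoin ℤ (Set.range v) →+* ℤ_[p] :=
    ((MvPolynomial.aeval x).comp hv.1.aevalEquiv.symm.toAlgHom).toRingHom
  -- `τ` carries `ℤ[v]` into `ℤ_[p]` by `v ↦ x`, so integral equations transfer; afterwards the unit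
  -- `Q(x)` is divided out.
  have h3 : IsIntegral ℤ_[p] (τ (hv.1.aevalEquiv Q • a)) := by
    refine (hint a ha).map_of_comp_eq φ τ.toRingHom ?_
    ext z
    obtain ⟨q, rfl⟩ := hv.1.aevalEquiv.surjective z
    have h1 : algebraMap (Algebra.adjoin ℤ (Set.range v)) ℂ (hv.1.aevalEquiv q) =
      MvPolynomial.aeval v q := hv.1.algebraMap_aevalEquiv q
    simpa [φ, h1] using (hτ' q).symm
  obtain ⟨u, hu⟩ := hunit
  have h4 : τ (hv.1.aevalEquiv Q • a) = (u : ℤ_[p]) • τ a := by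
    rw [Algebra.smul_def, map_mul, Algebra.smul_def, hu, ← hτ']
    congr 2
  have h5 : τ a = ((u⁻¹ : ℤ_[p]ˣ) : ℤ_[p]) • τ (hv.1.aevalEquiv Q • a) := by
    rw [h4, smul_smul]
    simp
  rw [h5]
  exact h3.smul _

/-! ### Finite generation of the fundamental group of a compact manifold -/

section FundamentalGroup

open CategoryTheory Topology Uniformity Set unitInterval

/-- Any two paths in `W` with the same end points are homotopic in the ambient space. -/
def PathsHomotopicWithin {X : Type*} [TopologicalSpace X] (W : Set X) : Prop :=
  ∀ ⦃a b : X⦄ (γ γ' : Path a b), (∀ t, γ t ∈ W) → (∀ t, γ' t ∈ W) → γ.Homotopic γ'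

theorem IsSimplyConnected.pathsHomotopicWithin {X : Type*} [TopologicalSpace X] {W : Set X}
    (hW : IsSimplyConnected W) : PathsHomotopicWithin W := by
  intro a b γ γ' h h'
  have := hW.simplyConnectedSpace
  have ha : a ∈ W := by simpa using h 0
  have hb : b ∈ W := by simpa using h 1
  let δ : Path (⟨a, ha⟩ : W) ⟨b, hb⟩ :=
    { toFun := fun t => ⟨γ t, h t⟩, source' := by simp, target' := by simp }
  let δ' : Path (⟨a, ha⟩ : W) ⟨b, hb⟩ :=
    { toFun := fun t => ⟨γ' t, h' t⟩, source' := by simp, target' := by simp }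
  exact (SimplyConnectedSpace.paths_homotopic δ δ').map ⟨Subtype.val, continuous_subtype_val⟩

/-- In a chart, the intersection of a ball with the half-space is convex, hence contractible. -/
theorem ChartedSpace.exists_mem_nhds_isSimplyConnected {n : ℕ} [NeZero n] {M : Type*}
    [TopologicalSpace M] [ChartedSpace (EuclideanHalfSpace n) M] (x : M) :
    ∃ W ∈ 𝓝 x, IsSimplyConnected W := by
  let e := chartAt (EuclideanHalfSpace n) x
  have hx : x ∈ e.source := mem_chart_source _ x
  obtain ⟨O, hO, hOe⟩ := isOpen_induced_iff.1 e.open_target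
  have hxO : e x ∈ Subtype.val ⁻¹' O := hOe ▸ e.map_source hx
  obtain ⟨r, hr, hball⟩ := Metric.isOpen_iff.1 hO (e x).1 hxO
  let B : Set (EuclideanHalfSpace n) := Subtype.val ⁻¹' Metric.ball (e x).1 r
  have hBe : B ⊆ e.target := hOe ▸ Set.preimage_mono hball
  have h1 : IsSimplyConnected B := by
    rw [← IsEmbedding.subtypeVal.isSimplyConnected_image]
    have : (Subtype.val '' B : Set (EuclideanSpace ℝ (Fin n))) =
        Metric.ball (e x).1 r ∩ {y | 0 ≤ y 0} := by
      exact (Subtype.image_preimage_coe _ _).trans (Set.inter_comm _ _)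
    rw [this]
    have := ((convex_ball (e x).1 r).inter EuclideanHalfSpace.convex).contractibleSpace
      ⟨(e x).1, Metric.mem_ball_self hr, (e x).2⟩
    exact inferInstanceAs (SimplyConnectedSpace _)
  have hemb : IsOpenEmbedding (e.symm.source.domRestrict e.symm) := e.symm.isOpenEmbedding_restrict
  have h2 : IsSimplyConnected (Subtype.val ⁻¹' B : Set e.symm.source) := by
    rw [← IsEmbedding.subtypeVal.isSimplyConnected_image, Subtype.image_preimage_coe,
      Set.inter_eq_right.2 (show B ⊆ e.symm.source from hBe)]
    exact h1
  refine ⟨_, ?_, hemb.isEmbedding.isSimplyConnected_image.2 h2⟩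
  refine (hemb.isOpenMap _ ((Metric.isOpen_ball.preimage
    continuous_subtype_val).preimage continuous_subtype_val)).mem_nhds ?_
  exact ⟨⟨e x, e.map_source hx⟩, Metric.mem_ball_self (x := (e x).1) hr, e.left_inv hx⟩

/-- By the Lebesgue number lemma, two overlapping members of a sufficiently fine cover lie together
in one of the given neighbourhoods. Path components of small balls form such a cover. -/
theorem exists_finite_cover_pathsHomotopicWithin_union {X : Type u} [TopologicalSpace X]
    [CompactSpace X] [T2Space X] [LocallyPathConnectedSpace X]
    (h : ∀ x : X, ∃ W ∈ 𝓝 x, PathsHomotopicWithin W) :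
    ∃ (ι : Type u) (_ : Finite ι) (U : ι → Set X), (∀ i, IsOpen (U i)) ∧
      (∀ i, IsPathConnected (U i)) ∧ (∀ x, ∃ i, x ∈ U i) ∧
      ∀ i j, (U i ∩ U j).Nonempty → PathsHomotopicWithin (U i ∪ U j) := by
  let := uniformSpaceOfCompactR1 (γ := X)
  choose W hW hWp using h
  obtain ⟨V, hV, hVW⟩ := lebesgue_number_lemma_nhds isCompact_univ fun x _ => hW x
  obtain ⟨T, hT, hTs, hTV⟩ := comp_comp_symm_mem_uniformity_sets hV
  let O (x : X) : Set X := pathComponentIn (interior (UniformSpace.ball x T)) x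
  have hxO (x : X) : x ∈ interior (UniformSpace.ball x T) :=
    mem_interior_iff_mem_nhds.2 (UniformSpace.ball_mem_nhds x hT)
  have hO (x : X) : IsOpen (O x) := isOpen_interior.pathComponentIn x
  have hOT (x y : X) (hy : y ∈ O x) : (x, y) ∈ T := by
    have := interior_subset (pathComponentIn_subset (show y ∈ O x from hy))
    exact this
  obtain ⟨t, -, ht⟩ := isCompact_univ.elim_nhds_subcover O fun x _ =>
    (hO x).mem_nhds (mem_pathComponentIn_self (hxO x))
  refine ⟨t, inferInstance, fun i => O i, fun i => hO _, fun i => isPathConnected_pathComponentIn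
    (hxO _), fun x => ?_, ?_⟩
  · obtain ⟨i, hi, hx⟩ := mem_iUnion₂.1 (ht (mem_univ x))
    exact ⟨⟨i, hi⟩, hx⟩
  · rintro i j ⟨z, hzi, hzj⟩
    obtain ⟨y, hy⟩ := hVW i (mem_univ _)
    have hsub : O i ∪ O j ⊆ W y := by
      refine Set.Subset.trans ?_ hy
      rintro w (hw | hw)
      · exact hTV ⟨i, ⟨i, refl_mem_uniformity hT, refl_mem_uniformity hT⟩, hOT _ _ hw⟩
      · exact hTV ⟨j, ⟨z, hOT _ _ hzi, hTs.symm _ _ (hOT _ _ hzj)⟩, hOT _ _ hw⟩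
    exact fun a b γ γ' h h' => hWp y γ γ' (fun t => hsub (h t)) fun t => hsub (h' t)

/-- The class of a path, as a morphism of the fundamental groupoid. -/
def Path.toHom {X : Type*} [TopologicalSpace X] {a b : X} (γ : Path a b) :
    FundamentalGroupoid.mk a ⟶ FundamentalGroupoid.mk b :=
  Path.Homotopic.Quotient.mk γ

theorem Path.toHom_trans {X : Type*} [TopologicalSpace X] {a b c : X} (γ : Path a b)
    (δ : Path b c) : (γ.trans δ).toHom = γ.toHom ≫ δ.toHom := rfl

theorem Path.toHom_eq {X : Type*} [TopologicalSpace X] {a b : X} {γ δ : Path a b}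
    (h : γ.Homotopic δ) : γ.toHom = δ.toHom := Quotient.sound h

/-- Any loop is cut into pieces lying in single members of the cover; joining the cut points to the
centres `b i` turns each piece into one of finitely many loops `g₁`. The loops `g₂` correct the base
point. -/
theorem fundamentalGroup_fg_of_pathsHomotopicWithin {X : Type u} [TopologicalSpace X]
    [CompactSpace X] [T2Space X] [PathConnectedSpace X] [LocallyPathConnectedSpace X]
    (h : ∀ x : X, ∃ W ∈ 𝓝 x, PathsHomotopicWithin W) (x₀ : X) :
    Group.FG (FundamentalGroup X x₀) := by
  obtain ⟨ι, _, U, hUo, hUp, hUc, hUh⟩ := exists_finite_cover_pathsHomotopicWithin_union h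
  choose b hb using fun i => (hUp i).nonempty
  have hc (i : ι) (y : X) : ∃ c : Path y (b i), y ∈ U i → ∀ t, c t ∈ U i := by
    by_cases hy : y ∈ U i
    · obtain ⟨c, hc⟩ := (hUp i).joinedIn y hy _ (hb i)
      exact ⟨c, fun _ => hc⟩
    · exact ⟨PathConnectedSpace.somePath _ _, fun h => (hy h).elim⟩
  choose c hc using hc
  let p (i : ι) : Path x₀ (b i) := PathConnectedSpace.somePath _ _
  have he (i j : ι) : ∃ e : Path (b i) (b j), (U i ∩ U j).Nonempty → ∀ t, e t ∈ U i ∪ U j := by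
    by_cases hij : (U i ∩ U j).Nonempty
    · obtain ⟨e, he⟩ := ((hUp i).union (hUp j) hij).joinedIn _ (Or.inl (hb i)) _ (Or.inr (hb j))
      exact ⟨e, fun _ => he⟩
    · exact ⟨PathConnectedSpace.somePath _ _, fun h => (hij h).elim⟩
  choose e he using he
  let g₁ (ij : ι × ι) : FundamentalGroup X x₀ :=
    (p ij.1).toHom ≫ (e ij.1 ij.2).toHom ≫ Groupoid.inv (p ij.2).toHom
  let g₂ (i : ι) : FundamentalGroup X x₀ := (c i x₀).toHom ≫ Groupoid.inv (p i).toHom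
  let H : Subgroup (FundamentalGroup X x₀) := Subgroup.closure (range g₁ ∪ range g₂)
  -- Multiplication in the fundamental group is composition in the opposite order.
  have hcomp {q r : FundamentalGroup X x₀} (hq : q ∈ H) (hr : r ∈ H) :
      (q ≫ r : FundamentalGroupoid.mk x₀ ⟶ FundamentalGroupoid.mk x₀) ∈ H := H.mul_mem hr hq
  let D (i j : ι) {a a' : X} (γ : Path a a') : FundamentalGroup X x₀ :=
    (p i).toHom ≫ Groupoid.inv (c i a).toHom ≫ γ.toHom ≫ (c j a').toHom ≫
      Groupoid.inv (p j).toHom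
  have hsmall {a a' : X} (γ : Path a a') {i k : ι} (ha : a ∈ U i) (hγ : ∀ t, γ t ∈ U k) :
      D i k γ ∈ H := by
    have hak : a ∈ U k := by simpa using hγ 0
    have hak' : a' ∈ U k := by simpa using hγ 1
    have hne : (U i ∩ U k).Nonempty := ⟨a, ha, hak⟩
    -- Both paths stay in `U i ∪ U k` and share their end points.
    have key : γ.toHom ≫ (c k a').toHom = (c i a).toHom ≫ (e i k).toHom := by
      rw [← Path.toHom_trans, ← Path.toHom_trans]
      refine Path.toHom_eq (hUh i k hne _ _ (fun t => ?_) fun t => ?_)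
      · have : (γ.trans (c k a')) t ∈ range (γ.trans (c k a')) := mem_range_self t
        rw [Path.trans_range] at this
        rcases this with ⟨s, hs⟩ | ⟨s, hs⟩
        · exact hs ▸ Or.inr (hγ s)
        · exact hs ▸ Or.inr (hc k a' hak' s)
      · have : ((c i a).trans (e i k)) t ∈ range ((c i a).trans (e i k)) := mem_range_self t
        rw [Path.trans_range] at this
        rcases this with ⟨s, hs⟩ | ⟨s, hs⟩
        · exact hs ▸ Or.inl (hc i a ha s)
        · exact hs ▸ he i k hne s
    have : D i k γ = g₁ (i, k) := by
      have : D i k γ = (p i).toHom ≫ Groupoid.inv (c i a).toHom ≫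
          (γ.toHom ≫ (c k a').toHom) ≫ Groupoid.inv (p k).toHom := by
        simp only [D, Category.assoc]
      rw [this, key]
      simp [g₁]
    rw [this]
    exact Subgroup.subset_closure (Or.inl (mem_range_self _))
  have htrans {a a' a'' : X} (γ : Path a a') (δ : Path a' a'') (i j k : ι) :
      D i k (γ.trans δ) = D i j γ ≫ D j k δ := by
    simp [D, Path.toHom_trans]
  have hcast {a a' d d' : X} (γ : Path a a') (hd : d = a) (hd' : d' = a') (i k : ι)
      (hD : D i k (γ.cast hd hd') ∈ H) : D i k γ ∈ H := by
    subst hd hd'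
    exact hD
  have hall {a a' : X} (γ : Path a a') {i k : ι} (ha : a ∈ U i) (ha' : a' ∈ U k) :
      D i k γ ∈ H := by
    obtain ⟨t, ht0, htm, ⟨n, hn⟩, htU⟩ := exists_monotone_Icc_subset_open_cover_unitInterval
      (c := fun i => γ ⁻¹' U i) (fun i => (hUo i).preimage γ.continuous)
      fun s _ => by simpa using hUc (γ s)
    have hind (n : ℕ) : ∀ k, γ (t n) ∈ U k → D i k (γ.subpath 0 (t n)) ∈ H := by
      induction n with
      | zero =>
        intro k hk
        rw [ht0] at hk ⊢
        refine hsmall _ (by simpa using ha) fun s => ?_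
        simpa using hk
      | succ n ih =>
        intro k hk
        obtain ⟨j, hj⟩ := htU n
        have hle : t n ≤ t (n + 1) := htm n.le_succ
        have hs (s : I) : γ.subpath (t n) (t (n + 1)) s ∈ U j := by
          have : γ.subpath (t n) (t (n + 1)) s ∈ range (γ.subpath (t n) (t (n + 1))) :=
            mem_range_self s
          rw [Path.range_subpath_of_le _ _ _ hle] at this
          obtain ⟨r, hr, hrs⟩ := this
          exact hrs ▸ hj hr
        -- The constant path at the end makes room to pass from `U j`, which contains the last
        -- piece, to the prescribed `U k`.
        have h1 : D i k (γ.subpath 0 (t (n + 1))) =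
            D i k ((γ.subpath 0 (t n)).trans ((γ.subpath (t n) (t (n + 1))).trans
              (Path.refl _))) := by
          simp only [D]
          rw [Path.toHom_eq (((Path.Homotopic.refl _).hcomp (Path.Homotopic.trans_refl _)).trans
            ⟨Path.Homotopy.subpathTransSubpath γ 0 (t n) (t (n + 1))⟩)]
        have hjn : γ (t n) ∈ U j := hj ⟨le_rfl, hle⟩
        rw [h1, htrans _ _ i j k, htrans _ _ j j k]
        refine hcomp (ih j hjn) (hcomp (hsmall _ hjn hs) (hsmall _ (hj ⟨hle, le_rfl⟩) ?_))
        simpa using hk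
    have := hind n k (by simpa [hn n le_rfl] using ha')
    rw [hn n le_rfl, Path.subpath_zero_one] at this
    exact hcast _ _ _ _ _ this
  refine Group.fg_iff.2 ⟨_, ?_, (finite_range g₁).union (finite_range g₂)⟩
  rw [eq_top_iff]
  rintro q -
  obtain ⟨γ, rfl⟩ := Quotient.exists_rep q
  obtain ⟨i, hi⟩ := hUc x₀
  have hg : g₂ i ∈ H := Subgroup.subset_closure (Or.inr (mem_range_self i))
  have hg' : (Groupoid.inv (g₂ i) : FundamentalGroupoid.mk x₀ ⟶ FundamentalGroupoid.mk x₀) ∈ H :=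
    H.inv_mem hg
  have h2 := hcomp hg (hcomp (hall γ hi hi) hg')
  have h3 : g₂ i ≫ D i i γ ≫ Groupoid.inv (g₂ i) = γ.toHom := by
    simp [D, g₂]
  rw [h3] at h2
  exact h2

theorem fundamentalGroup_fg_of_chartedSpace_euclideanHalfSpace {n : ℕ} [NeZero n] {M : Type u}
    [TopologicalSpace M] [ChartedSpace (EuclideanHalfSpace n) M] [T2Space M] [CompactSpace M]
    [ConnectedSpace M] (x₀ : M) : Group.FG (FundamentalGroup M x₀) := by
  have : LocallyPathConnectedSpace M :=
    ChartedSpace.locallyPathConnectedSpace (EuclideanHalfSpace n) M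
  have : PathConnectedSpace M := .of_locallyPathConnectedSpace
  refine fundamentalGroup_fg_of_pathsHomotopicWithin (fun x => ?_) x₀
  obtain ⟨W, hW, hW'⟩ := ChartedSpace.exists_mem_nhds_isSimplyConnected (n := n) x
  exact ⟨W, hW, hW'.pathsHomotopicWithin⟩

end FundamentalGroup

/-! ### Representations with the same linear span -/

section Span

variable {G H : Type u} [Group G] [Group H] {n : ℕ}

/-- The linear span of the image of a homomorphism to `SL(n, R)`. -/
def slSpan {R : Type*} [CommRing R] (ρ : G →* SL(n, R)) :
    Submodule R (Matrix (Fin n) (Fin n) R) :=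
  Submodule.span R (Set.range fun g => (ρ g : Matrix (Fin n) (Fin n) R))

theorem coe_mem_slSpan {R : Type*} [CommRing R] (ρ : G →* SL(n, R)) (g : G) :
    (ρ g : Matrix (Fin n) (Fin n) R) ∈ slSpan ρ :=
  Submodule.subset_span (Set.mem_range_self g)

/-- A subspace stable under a set of matrices is stable under their linear span. -/
theorem slRepresentation_mem_of_slSpan_le {ρ : G →* SL(n, ℂ)} {φ : H →* SL(n, ℂ)}
    (h : slSpan φ ≤ slSpan ρ) {W : Submodule ℂ (Fin n → ℂ)}
    (hW : ∀ g, ∀ v ∈ W, slRepresentation ρ g v ∈ W) (g : H) {v : Fin n → ℂ} (hv : v ∈ W) :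
    slRepresentation φ g v ∈ W := by
  have key : ∀ m ∈ slSpan ρ, Matrix.toLin' m v ∈ W := by
    intro m hm
    induction hm using Submodule.span_induction with
    | mem m hm =>
      obtain ⟨g, rfl⟩ := hm
      exact hW g v hv
    | zero => simp
    | add x y _ _ hx hy => simpa using W.add_mem hx hy
    | smul c x _ hx => simpa using W.smul_mem c hx
  exact key _ (h (coe_mem_slSpan φ g))

theorem slRepresentation_isIrreducible_of_slSpan_eq {ρ : G →* SL(n, ℂ)} {φ : H →* SL(n, ℂ)}
    (h : slSpan φ = slSpan ρ) (hρ : (slRepresentation ρ).IsIrreducible) :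
    (slRepresentation φ).IsIrreducible := by
  let e : Subrepresentation (slRepresentation φ) ≃o Subrepresentation (slRepresentation ρ) :=
    { toFun := fun W => ⟨W.toSubmodule, fun g _ hv =>
        slRepresentation_mem_of_slSpan_le h.ge W.apply_mem_toSubmodule g hv⟩
      invFun := fun W => ⟨W.toSubmodule, fun g _ hv =>
        slRepresentation_mem_of_slSpan_le h.le W.apply_mem_toSubmodule g hv⟩
      left_inv := fun _ => rfl
      right_inv := fun _ => rfl
      map_rel_iff' := Iff.rfl }
  exact e.isSimpleOrder_iff.2 hρ

theorem isNonabelianRep_of_slSpan_le {ρ : G →* SL(n, ℂ)} {φ : H →* SL(n, ℂ)}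
    (h : slSpan ρ ≤ slSpan φ) (hρ : IsNonabelianRep ρ) : IsNonabelianRep φ := by
  by_contra hφ
  simp only [IsNonabelianRep, not_exists, not_not] at hφ
  have key : ∀ x ∈ slSpan φ, ∀ y ∈ slSpan φ, Commute x y := by
    intro x hx y hy
    induction hx, hy using Submodule.span_induction₂ with
    | mem_mem x y hx hy =>
      obtain ⟨a, rfl⟩ := hx
      obtain ⟨b, rfl⟩ := hy
      exact congrArg Subtype.val (hφ a b)
    | zero_left => exact Commute.zero_left _
    | zero_right => exact Commute.zero_right _
    | add_left _ _ _ _ _ _ h h' => exact h.add_left h'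
    | add_right _ _ _ _ _ _ h h' => exact h.add_right h'
    | smul_left c _ _ _ _ h => exact h.smul_left c
    | smul_right c _ _ _ _ h => exact h.smul_right c
  obtain ⟨a, b, hab⟩ := hρ
  exact hab (Subtype.ext (key _ (h (coe_mem_slSpan ρ a)) _ (h (coe_mem_slSpan ρ b))))

theorem slSpan_map_le {R S : Type*} [CommRing R] [CommRing S] (j : R →+* S) {ρ : G →* SL(n, R)}
    {φ : H →* SL(n, R)} (h : slSpan φ ≤ slSpan ρ) :
    slSpan ((Matrix.SpecialLinearGroup.map j).comp φ) ≤
      slSpan ((Matrix.SpecialLinearGroup.map j).comp ρ) := by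
  have key : ∀ m ∈ slSpan ρ, m.map j ∈ slSpan ((Matrix.SpecialLinearGroup.map j).comp ρ) := by
    intro m hm
    induction hm using Submodule.span_induction with
    | mem m hm =>
      obtain ⟨g, rfl⟩ := hm
      exact coe_mem_slSpan ((Matrix.SpecialLinearGroup.map j).comp ρ) g
    | zero => simp
    | add x y _ _ hx hy =>
      rw [Matrix.map_add j (map_add j)]
      exact Submodule.add_mem _ hx hy
    | smul c x _ hx =>
      have : (c • x).map j = j c • x.map j := by ext; simp
      rw [this]
      exact Submodule.smul_mem _ _ hx
  refine Submodule.span_le.2 ?_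
  rintro _ ⟨g, rfl⟩
  exact key _ (h (coe_mem_slSpan φ g))

end Span

/-! ### Compact coefficient rings -/

/-- The submodule is finitely generated, hence a continuous image of the compact space `R^k`. -/
theorem Submodule.isClosed_of_isNoetherianRing_of_compactSpace {R M : Type*} [CommRing R]
    [TopologicalSpace R] [CompactSpace R] [IsNoetherianRing R] [AddCommGroup M] [Module R M]
    [Module.Finite R M] [TopologicalSpace M] [ContinuousAdd M] [ContinuousSMul R M] [T2Space M]
    (N : Submodule R M) : IsClosed (N : Set M) :=
  (Submodule.isCompact_of_fg (IsNoetherian.noetherian N)).isClosed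

section CompactRing

variable {n : ℕ} {R : Type*} [CommRing R] [TopologicalSpace R] [IsTopologicalRing R]

instance Matrix.SpecialLinearGroup.compactSpace [T2Space R] [CompactSpace R] :
    CompactSpace SL(n, R) :=
  have : CompactSpace (Matrix (Fin n) (Fin n) R) :=
    inferInstanceAs (CompactSpace (Fin n → Fin n → R))
  Matrix.SpecialLinearGroup.isClosedEmbedding_val.compactSpace

instance Matrix.SpecialLinearGroup.totallyDisconnectedSpace [TotallyDisconnectedSpace R] :
    TotallyDisconnectedSpace SL(n, R) :=
  have : TotallyDisconnectedSpace (Matrix (Fin n) (Fin n) R) :=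
    inferInstanceAs (TotallyDisconnectedSpace (Fin n → Fin n → R))
  inferInstanceAs (TotallyDisconnectedSpace (Subtype _))

/-- The span of the image of `G` is closed, so by density it contains the image of all of `K`. -/
theorem slSpan_le_of_denseRange [T2Space R] [CompactSpace R] [IsNoetherianRing R] {G H K : Type*}
    [Group G] [Group H] [Group K] [TopologicalSpace K] {ρ : K →* SL(n, R)} (hρ : Continuous ρ)
    {i : G →* K} (hi : DenseRange i) (k : H →* K) :
    slSpan (ρ.comp k) ≤ slSpan (ρ.comp i) := by
  have hcl : IsClosed {x : K | (ρ x : Matrix (Fin n) (Fin n) R) ∈ slSpan (ρ.comp i)} :=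
    (Submodule.isClosed_of_isNoetherianRing_of_compactSpace (slSpan (ρ.comp i))).preimage
      (continuous_subtype_val.comp hρ)
  refine Submodule.span_le.2 ?_
  rintro _ ⟨g, rfl⟩
  exact hi.induction_on (p := fun x => (ρ x : Matrix (Fin n) (Fin n) R) ∈ slSpan (ρ.comp i)) (k g)
    hcl (coe_mem_slSpan (ρ.comp i))

end CompactRing

/-- A complex representation of a finitely generated group is defined over a compact noetherian
ring, namely a finite integral extension of `ℤ_[p]` for some prime `p`, via an embedding of that
ring into `ℂ`. -/
theorem exists_compact_model {G : Type u} [Group G] [Group.FG G] {n : ℕ} (θ : G →* SL(n, ℂ)) :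
    ∃ (R : Type) (_ : CommRing R) (_ : TopologicalSpace R) (_ : IsTopologicalRing R)
      (_ : CompactSpace R) (_ : T2Space R) (_ : TotallyDisconnectedSpace R)
      (_ : IsNoetherianRing R) (j : R →+* ℂ) (ρ : G →* SL(n, R)),
      (Matrix.SpecialLinearGroup.map j).comp ρ = θ := by
  obtain ⟨S, hS, hSfin⟩ := Group.fg_iff.1 ‹Group.FG G›
  have hfin : (⋃ g ∈ S, Set.range fun ab : Fin n × Fin n => θ g ab.1 ab.2).Finite :=
    hSfin.biUnion fun g _ => Set.finite_range _
  obtain ⟨p, _, τ, hτ⟩ := exists_ringEquiv_padicAlgCl_isIntegral hfin.toFinset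
  let T : Set (PadicAlgCl p) := τ '' hfin.toFinset
  let R : Subalgebra ℤ_[p] (PadicAlgCl p) := Algebra.adjoin ℤ_[p] T
  have hfg : R.toSubmodule.FG := by
    refine fg_adjoin_of_finite (hfin.toFinset.finite_toSet.image τ) ?_
    rintro _ ⟨a, ha, rfl⟩
    exact hτ a ha
  have : Module.Finite ℤ_[p] R := Module.Finite.iff_fg.2 hfg
  have : ContinuousSMul ℤ_[p] (PadicAlgCl p) := by
    refine continuousSMul_of_algebraMap _ _ ?_
    rw [IsScalarTower.algebraMap_eq ℤ_[p] ℚ_[p] (PadicAlgCl p)]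
    exact (continuous_algebraMap ℚ_[p] (PadicAlgCl p)).comp continuous_subtype_val
  have hcomp : CompactSpace R := isCompact_iff_compactSpace.1 (Submodule.isCompact_of_fg hfg)
  have hnoeth : IsNoetherianRing R := .of_finite ℤ_[p] R
  let incl : R →+* PadicAlgCl p := R.val.toRingHom
  have hincl : Function.Injective incl := Subtype.val_injective
  let θ' : G →* SL(n, PadicAlgCl p) := (Matrix.SpecialLinearGroup.map τ.toRingHom).comp θ
  have hmapinj : Function.Injective (Matrix.SpecialLinearGroup.map (n := Fin n) incl) := by
    intro A B hAB
    ext a b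
    exact congrArg (fun M : SL(n, PadicAlgCl p) => M a b) hAB
  -- Entries in `R` are needed on generators alone: the image of `SL(n, R)` is a subgroup, so
  -- inverses come for free.
  have hrange (g : G) : θ' g ∈ (Matrix.SpecialLinearGroup.map (n := Fin n) incl).range := by
    have hle : Subgroup.closure S ≤
        (Matrix.SpecialLinearGroup.map (n := Fin n) incl).range.comap θ' := by
      rw [Subgroup.closure_le]
      intro g hg
      have hmem (a b : Fin n) : τ (θ g a b) ∈ R := by
        refine Algebra.subset_adjoin ⟨_, ?_, rfl⟩
        rw [hfin.coe_toFinset]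
        exact Set.mem_biUnion hg ⟨(a, b), rfl⟩
      refine ⟨⟨Matrix.of fun a b => ⟨τ (θ g a b), hmem a b⟩, hincl ?_⟩, ?_⟩
      · rw [RingHom.map_det, map_one]
        exact (θ' g).2
      · ext a b
        rfl
    exact hle (hS ▸ Subgroup.mem_top g)
  let ρ : G →* SL(n, R) :=
    (MonoidHom.ofInjective hmapinj).symm.toMonoidHom.comp (θ'.codRestrict _ hrange)
  have hρ (g : G) : Matrix.SpecialLinearGroup.map incl (ρ g) = θ' g :=
    congrArg Subtype.val ((MonoidHom.ofInjective hmapinj).apply_symm_apply ⟨θ' g, hrange g⟩)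
  refine ⟨R, inferInstance, inferInstance, inferInstance, hcomp, inferInstance, inferInstance,
    hnoeth, τ.symm.toRingHom.comp incl, ρ, ?_⟩
  ext g a b
  have h1 : incl (ρ g a b) = τ (θ g a b) := congrArg (fun M : SL(n, PadicAlgCl p) => M a b) (hρ g)
  have h2 : τ.symm (incl (ρ g a b)) = θ g a b := by rw [h1, τ.symm_apply_apply]
  exact h2

/-! ### Profinite completions -/

theorem denseRange_toHat (G : Type u) [Group G] : DenseRange (toHat G) :=
  ProfiniteGrp.ProfiniteCompletion.denseRange (GrpCat.of G)

open CategoryTheory in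
theorem hatMap_toHat {G H : Type u} [Group G] [Group H] (φ : G →* H) (g : G) :
    hatMap φ (toHat G g) = toHat H (φ g) :=
  ConcreteCategory.congr_hom (ProfiniteGrp.ProfiniteCompletion.lift_eta
    (GrpCat.ofHom φ ≫ ProfiniteGrp.ProfiniteCompletion.eta (GrpCat.of H))) g

open CategoryTheory in
theorem exists_continuous_extension_toHat {G : Type u} [Group G] {K : Type} [Group K]
    [TopologicalSpace K] [IsTopologicalGroup K] [CompactSpace K] [TotallyDisconnectedSpace K]
    (ρ : G →* K) : ∃ ρ' : ProfiniteHat G →* K, Continuous ρ' ∧ ρ'.comp (toHat G) = ρ := by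
  have : TotallyDisconnectedSpace (ULift.{u} K) :=
    Homeomorph.ulift.symm.totallyDisconnectedSpace
  let P : ProfiniteGrp.{u} := ProfiniteGrp.of (ULift.{u} K)
  let ι : GrpCat.of G ⟶ GrpCat.of P :=
    GrpCat.ofHom ((MulEquiv.ulift (α := K)).symm.toMonoidHom.comp ρ)
  let l := (ProfiniteGrp.ProfiniteCompletion.lift ι).hom
  refine ⟨(MulEquiv.ulift (α := K)).toMonoidHom.comp l.toMonoidHom,
    continuous_uliftDown.comp l.continuous_toFun, ?_⟩
  ext g
  exact congrArg ULift.down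
    (ConcreteCategory.congr_hom (ProfiniteGrp.ProfiniteCompletion.lift_eta ι) g)

/-- Transfer of representations along an isomorphism of profinite completions: a model of `θ` over
a compact ring extends to the profinite completion of `H`, and is pulled back along `f`. -/
theorem exists_representation_of_profiniteHat_equiv {G H : Type u} [Group G] [Group H]
    [Group.FG H] (f : ProfiniteHat G ≃ₜ* ProfiniteHat H) {n : ℕ} (θ : H →* SL(n, ℂ)) :
    ∃ (φ : G →* SL(n, ℂ)) (B : ProfiniteHat H → SL(n, ℂ)),
      (∀ (x : ProfiniteHat H) (a : G) (b : H), x * f (toHat G a) * x⁻¹ = toHat H b →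
        φ a = B x * θ b * (B x)⁻¹) ∧ slSpan φ = slSpan θ := by
  obtain ⟨R, _, _, _, _, _, _, _, j, ρ, rfl⟩ := exists_compact_model θ
  obtain ⟨ρ', hρ', rfl⟩ := exists_continuous_extension_toHat ρ
  let i : G →* ProfiniteHat H := f.toMonoidHom.comp (toHat G)
  have hi : DenseRange i := f.surjective.denseRange.comp (denseRange_toHat G) f.continuous
  -- The conjugator is the image of `x⁻¹` because the hypothesis reads `f(a) = x⁻¹ b x`. The spans
  -- are compared over `R`, where closedness is available, and then carried to `ℂ` by `j`, which
  -- need not be continuous.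
  refine ⟨(Matrix.SpecialLinearGroup.map j).comp (ρ'.comp i),
    fun x => Matrix.SpecialLinearGroup.map j (ρ' x⁻¹), fun x a b hab => ?_, le_antisymm ?_ ?_⟩
  · have : i a = x⁻¹ * toHat H b * (x⁻¹)⁻¹ := by
      rw [← hab]
      simp only [mul_assoc, inv_mul_cancel_left, inv_inv, inv_mul_cancel, mul_one]
      rfl
    simp only [MonoidHom.comp_apply, this, map_mul, map_inv]
  · exact slSpan_map_le j (slSpan_le_of_denseRange hρ' (denseRange_toHat H) i)
  · exact slSpan_map_le j (slSpan_le_of_denseRange hρ' hi (toHat H))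

theorem mainTheorem8
    {M : Type u} [TopologicalSpace M] [ChartedSpace (EuclideanHalfSpace 3) M]
    [T2Space M] [CompactSpace M] [ConnectedSpace M]
    {N : Type u} [TopologicalSpace N] [ChartedSpace (EuclideanHalfSpace 3) N]
    [T2Space N] [CompactSpace N] [ConnectedSpace N]
    (hM : HasIncompressibleToralBoundary M) (hN : HasIncompressibleToralBoundary N)
    (x₀ : M) (y₀ : N)
    (P : BoundaryComponent M → Subgroup (FundamentalGroup M x₀))
    (hP : ∀ i, IsPeripheralSubgroup x₀ i (P i))
    (Q : BoundaryComponent N → Subgroup (FundamentalGroup N y₀))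
    (hQ : ∀ j, IsPeripheralSubgroup y₀ j (Q j))
    (f : ProfiniteHat (FundamentalGroup M x₀) ≃ₜ* ProfiniteHat (FundamentalGroup N y₀))
    (S : PeripheralRegularData P Q f)
    (n : ℕ) (θ : FundamentalGroup N y₀ →* SL(n, ℂ)) :
    ∃ φ : FundamentalGroup M x₀ →* SL(n, ℂ),
      (∀ i : BoundaryComponent M, ∃ A : SL(n, ℂ), ∀ α : P i,
        φ (α : FundamentalGroup M x₀) =
          A * θ (S.ψ i α : FundamentalGroup N y₀) * A⁻¹) ∧
      (IsNonabelianRep θ → IsNonabelianRep φ) ∧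
      ((slRepresentation θ).IsIrreducible → (slRepresentation φ).IsIrreducible) := by
  have : Group.FG (FundamentalGroup N y₀) :=
    fundamentalGroup_fg_of_chartedSpace_euclideanHalfSpace (n := 3) y₀
  obtain ⟨φ, B, hB, hspan⟩ := exists_representation_of_profiniteHat_equiv f θ
  refine ⟨φ, fun i => ⟨B (S.g i), fun α => hB _ _ _ ?_⟩, isNonabelianRep_of_slSpan_le hspan.ge,
    slRepresentation_isIrreducible_of_slSpan_eq hspan⟩
  -- At an element of the discrete group `P i` the regularity condition says that `g i` conjugates
  -- `f(α)` to `ψ i α`.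
  have h := S.completion_eq i (toHat (P i) α)
  rw [hatMap_toHat, hatMap_toHat, hatMap_toHat] at h
  exact h
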